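/- Let $p$ be a prime, $k$ a field of characteristic $p$, $M$ a lattice (a finitely generated free abelian group), $\sigma\subseteq M_{\mathbb R}=\mathbb R\otimes_{\mathbb Z} M$ a rational convex polyhedral cone (generated by finitely many elements of $M$), $S=\sigma\cap M$, and $R=k[S]\subseteq k[M]$ the semigroup ring. Let $e\ge 1$ be an integer and let $\kappa:k\to k$ be an additive map with $\kappa(1)=1$ and $\kappa(a^{p^e}b)=a\,\kappa(b)$ for all $a,b\in k$ (if $k$ is perfect, $\kappa$ is necessarily $c\mapsto c^{1/p^e}$). Let $\phi_c:k[M]\to k[M]$ be the canonical splitting of the $e$-th iterated Frobenius, i.e. the additive map with $\phi_c(c\,x^{u})=\kappa(c)\,x^{u/p^e}$ if $u\in p^eM$ and $\phi_c(c\,x^u)=0$ otherwise. Let $w\in M$ be such that $f\mapsto \phi_c(x^{-w}f)$ maps $R$ into $R$, and let $\phi:R\to R$, $\phi(f)=\phi_c(x^{-w}f)$, be the resulting toric $p^{-e}$-linear map. Let $\mathfrak a\subseteq R$ be a monomial ideal and $t\ge 0$ a rational number whose denominator is not divisible by $p$. For an ideal $J$, write $\overline J$ for its integral closure, and put $J^0=R$.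 Then there are only finitely many ideals $I\subseteq R$ such that $$\sum_{n}\phi^n\bigl(\overline{\mathfrak a^{\,t(p^{ne}-1)}}\cdot I\bigr)=I,$$ where the sum is taken over all integers $n>0$ such that $t(p^{ne}-1)$ is an integer. -/

import Mathlib

open scoped TensorProduct

noncomputable section

namespace ToricCartier

section IntegralClosure

open Polynomial

variable {R : Type*} [CommRing R]

/-- `x` is integral over the ideal `I`: it satisfies an equation
`x ^ n + a₁ x ^ (n - 1) + ⋯ + aₙ = 0` with `aⱼ ∈ I ^ j`. -/
def IsIntegralOverIdeal (I : Ideal R) (x : R) : Prop :=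
  ∃ q : R[X], q.Monic ∧ q.eval x = 0 ∧ ∀ i, q.coeff i ∈ I ^ (q.natDegree - i)

theorem isIntegralOverIdeal_iff (I : Ideal R) (x : R) :
    IsIntegralOverIdeal I x ↔ IsIntegral (reesAlgebra I) (C x * X : R[X]) := by
  constructor
  · rintro ⟨q, hq, hx, hc⟩
    let c : ℕ → reesAlgebra I := fun i =>
      ⟨monomial (q.natDegree - i) (q.coeff i), reesAlgebra.monomial_mem.2 (hc i)⟩
    refine ⟨∑ i ∈ Finset.range (q.natDegree + 1), C (c i) * X ^ i, ?_, ?_⟩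
    · have h1 : c q.natDegree = 1 := by
        apply Subtype.ext
        simp [c, hq.coeff_natDegree]
      rw [Finset.sum_range_succ, h1, add_comm, C_1, one_mul]
      refine monic_X_pow_add ?_
      refine lt_of_le_of_lt (degree_sum_le _ _) ?_
      rw [Finset.sup_lt_iff (WithBot.bot_lt_coe _)]
      intro i hi
      exact lt_of_le_of_lt (degree_C_mul_X_pow_le i _)
        (WithBot.coe_lt_coe.2 (Finset.mem_range.1 hi))
    · rw [eval₂_finsetSum]
      have h2 : ∀ i ∈ Finset.range (q.natDegree + 1),
          eval₂ (algebraMap (reesAlgebra I) R[X]) (C x * X) (C (c i) * X ^ i)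
            = monomial q.natDegree (q.coeff i * x ^ i) := by
        intro i hi
        have h3 : q.natDegree - i + i = q.natDegree := by
          have := Finset.mem_range.1 hi
          omega
        rw [eval₂_mul, eval₂_C, eval₂_pow, eval₂_X, mul_pow, ← C_pow, C_mul_X_pow_eq_monomial]
        change monomial (q.natDegree - i) (q.coeff i) * monomial i (x ^ i) = _
        rw [monomial_mul_monomial, h3]
      rw [Finset.sum_congr rfl h2, ← map_sum, ← eval_eq_sum_range, hx, map_zero]
  · intro h
    have hA : reesAlgebra I = Algebra.adjoin R { C r * X | r ∈ I } := by
      rw [← adjoin_monomial_eq_reesAlgebra]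
      congr 1
      ext f
      simp [C_mul_X_eq_monomial]
    rw [hA] at h
    obtain ⟨q, hq, hx, hc⟩ : ∃ q : R[X], q.Monic ∧ aeval x q = 0 ∧
        ∀ i, q.coeff i ∈ I ^ (q.natDegree - i) := by
      apply exists_monic_aeval_eq_zero_forall_mem_pow_of_isIntegral
      obtain ⟨r, hr, hx⟩ := h
      refine ⟨r, hr, ?_⟩
      convert hx using 2
      ext a
      simp [Subalgebra.algebraMap_def, Polynomial.algebraMap_def]
    exact ⟨q, hq, by simpa [aeval_def] using hx, hc⟩

/-- The integral closure of an ideal: the ideal of all elements integral over it. -/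
def idealIntegralClosure (I : Ideal R) : Ideal R where
  carrier := { x | IsIntegralOverIdeal I x }
  zero_mem' := by
    change IsIntegralOverIdeal I 0
    rw [isIntegralOverIdeal_iff]
    simpa using (isIntegral_zero : IsIntegral (reesAlgebra I) (0 : R[X]))
  add_mem' := by
    intro x y hx hy
    change IsIntegralOverIdeal I (x + y)
    change IsIntegralOverIdeal I x at hx
    change IsIntegralOverIdeal I y at hy
    rw [isIntegralOverIdeal_iff] at *
    simpa [add_mul] using hx.add hy
  smul_mem' := by
    intro r x hx
    change IsIntegralOverIdeal I (r * x)
    change IsIntegralOverIdeal I x at hx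
    rw [isIntegralOverIdeal_iff] at *
    have hr : IsIntegral (reesAlgebra I) (C r : R[X]) :=
      isIntegral_algebraMap (x := algebraMap R (reesAlgebra I) r)
    simpa [mul_assoc] using hr.mul hx

end IntegralClosure

section Fixed

variable {R : Type*} [CommRing R]

/-- The sum of all `φⁿ(J_m · I)`, where `J_m` is the integral closure of `𝔞 ^ m`, over the integers
`n > 0` for which `m = t (p ^ (n e) - 1)` is a (natural) number. -/
def cartierSum (p e : ℕ) (φ : AddMonoid.End R) (𝔞 : Ideal R) (t : ℚ) (I : Ideal R) :
    AddSubgroup R :=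
  ⨆ (n : ℕ) (m : ℕ) (_ : 0 < n ∧ (m : ℚ) = t * ((p : ℚ) ^ (n * e) - 1)),
    (idealIntegralClosure (𝔞 ^ m) * I).toAddSubgroup.map (φ ^ n)

/-- `I` is fixed by the Cartier algebra of the triple `(R, φ, 𝔞 ^ t)`. -/
def IsCartierFixed (p e : ℕ) (φ : AddMonoid.End R) (𝔞 : Ideal R) (t : ℚ) (I : Ideal R) : Prop :=
  cartierSum p e φ 𝔞 t I = I.toAddSubgroup

end Fixed

section Toric

variable {M : Type*} [AddCommGroup M]

/-- A cone in `M_ℝ = ℝ ⊗ M` generated by finitely many vectors of the lattice `M`. -/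
def IsRationalPolyhedral (σ : PointedCone ℝ (ℝ ⊗[ℤ] M)) : Prop :=
  ∃ s : Finset M, σ = PointedCone.hull ℝ ((fun m : M => (1 : ℝ) ⊗ₜ[ℤ] m) '' (s : Set M))

/-- The monoid `S = M ∩ σ`. -/
def latticePoints (σ : PointedCone ℝ (ℝ ⊗[ℤ] M)) : AddSubmonoid M where
  carrier := { m | (1 : ℝ) ⊗ₜ[ℤ] m ∈ σ }
  zero_mem' := by simp
  add_mem' := by
    intro a b ha hb
    simpa [TensorProduct.tmul_add] using σ.add_mem ha hb

/-- The inclusion of semigroup rings `k[S] ⊆ k[M]`. -/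
def inclusion (k : Type*) [Field k] (S : AddSubmonoid M) :
    AddMonoidAlgebra k S →+* AddMonoidAlgebra k M :=
  AddMonoidAlgebra.mapDomainRingHom k S.subtype

/-- An ideal of `k[S]` generated by monomials. -/
def IsMonomialIdeal {k : Type*} [Field k] {S : AddSubmonoid M}
    (𝔞 : Ideal (AddMonoidAlgebra k S)) : Prop :=
  ∃ A : Set S, 𝔞 = Ideal.span ((fun s => AddMonoidAlgebra.single s (1 : k)) '' A)

/-- A `p⁻ᵉ`-linear splitting `κ : k → k` of the `e`-th iterate of the Frobenius of `k`.
If `k` is perfect there is exactly one, the inverse of that iterate. -/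
def IsFrobeniusSplitting {k : Type*} [Field k] (p e : ℕ) (κ : k →+ k) : Prop :=
  κ 1 = 1 ∧ ∀ a b : k, κ (a ^ p ^ e * b) = a * κ b

/-- The canonical splitting on `k[M]`, with `κ` acting on the coefficients: `c x^u` is sent to
`κ(c) x^v` if `u = p ^ e v` with `v ∈ M`, and to `0` if `u` is not divisible by `p ^ e` in `M`. -/
def canonicalSplitting {k : Type*} [Field k] [IsAddTorsionFree M] (p : ℕ) [Fact p.Prime] (e : ℕ)
    (κ : k →+ k) : AddMonoidAlgebra k M →+ AddMonoidAlgebra k M where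
  toFun f := (f.comapDomain (fun v : M => p ^ e • v)
    (nsmul_right_injective (pow_ne_zero e (Fact.out : p.Prime).ne_zero))).map κ
  map_zero' := by ext; simp
  map_add' := by intro f g; ext; simp

/-- `φ : k[S] → k[S]` is the toric map `φ_c(x^(-w) · _)`; in particular, the right-hand side takes
`k[S]` into itself. -/
def IsToricMap {k : Type*} [Field k] [IsAddTorsionFree M] {S : AddSubmonoid M}
    (p : ℕ) [Fact p.Prime] (e : ℕ) (κ : k →+ k) (w : M)
    (φ : AddMonoid.End (AddMonoidAlgebra k S)) : Prop :=
  ∀ f, inclusion k S (φ f) =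
    canonicalSplitting p e κ (AddMonoidAlgebra.single (-w) 1 * inclusion k S f)

end Toric

end ToricCartier

end

open ToricCartier

/-! Write q = p^e and w_n = (1 + q + ⋯ + q^(n-1)) w. The coefficient of φ^n f at v is κ^n of the
coefficient of f at q^n v + w_n. The integral closures of all powers 𝔞^m are spanned by the
monomials in the height-m slices of one cone in M × ℤ, cut out by a finite set L of integral forms
(`exists_dual_integralClosure`).

Let I be fixed, and let U be the finite set of exponents occurring in a finite generating set of I.
Iterating the fixed-point equation, each exponent v of I has q^n v + w_n - u in the slice at height
t(q^n - 1), with u ∈ U and n arbitrarily large (`IsCartierFixed.exists_ge`). Conversely, once n is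
so large that no two points of U are congruent modulo q^n M, such a relation isolates one term of a
generator and puts x^v in I (`IsCartierFixed.single_mem`). So I is monomial.

By `map_slice_eq`, a form l ∈ L takes the value (q^n - 1) λ_l(v) + l(v) - l(u) at that point, where
λ_l(v) is the value of l at (v + w/(q-1), t). For large n, nonnegativity excludes λ_l(v) < 0 and is
automatic if λ_l(v) > 0; if λ_l(v) = 0, it involves v only through l(v), which is then determined by
l. So, among v with all λ_l(v) ≥ 0, membership depends only on the face {l ∈ L | λ_l(v) = 0}. There
are finitely many faces, hence finitely many I. -/

namespace ToricCartier

/-! ### Weyl's theorem and Gordan's lemma over ℤ -/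

section Weyl

variable {N : Type*} [AddCommGroup N] [Module.Finite ℤ N]

/-- An integral form of Weyl's theorem: the saturation of a finitely generated submonoid of a
lattice is cut out by finitely many linear inequalities. -/
theorem exists_finite_dual [IsAddTorsionFree N] {G : Set N} (hG : G.Finite) :
    ∃ L : Set (N →+ ℤ), L.Finite ∧
      ∀ x, (∃ k : ℕ, 0 < k ∧ k • x ∈ AddSubmonoid.closure G) ↔ ∀ l ∈ L, 0 ≤ l x := by
  induction G, hG using Set.Finite.induction_on with
  | empty =>
    let b := Module.Free.chooseBasis ℤ N
    refine ⟨Set.range (fun i => (b.coord i).toAddMonoidHom) ∪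
      Set.range (fun i => -(b.coord i).toAddMonoidHom),
      (Set.finite_range _).union (Set.finite_range _), fun x => ?_⟩
    simp only [AddSubmonoid.closure_empty, AddSubmonoid.mem_bot]
    constructor
    · rintro ⟨k, hk, hx⟩ l -
      rw [(nsmul_eq_zero_iff.1 hx).resolve_right hk.ne', map_zero]
    · intro h
      refine ⟨1, one_pos, ?_⟩
      rw [one_smul, ← b.repr.map_eq_zero_iff]
      ext i
      have h1 := h _ (Or.inl ⟨i, rfl⟩)
      have h2 := h _ (Or.inr ⟨i, rfl⟩)
      simp at h1 h2
      simpa using le_antisymm h2 h1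
  | @insert g G _ _ ih =>
    obtain ⟨L, hL, ih⟩ := ih
    let P := {l ∈ L | 0 ≤ l g}
    let Q := {l ∈ L | l g < 0}
    have hP : P.Finite := hL.subset (Set.sep_subset _ _)
    have hQ : Q.Finite := hL.subset (Set.sep_subset _ _)
    -- Fourier–Motzkin elimination: x lies in the new cone iff k x - n g lies in the old one for
    -- some k > 0, n ≥ 0. Forms positive at g bound n / k above, forms in Q bound it below, and the
    -- mixed forms say that these bounds are compatible.
    refine ⟨P ∪ Set.image2 (fun a b => a g • b - b g • a) P Q,
      hP.union (hP.image2 _ hQ), fun x => ⟨?_, fun h => ?_⟩⟩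
    · rintro ⟨k, hk, hx⟩
      have hpos : ∀ l : N →+ ℤ, (∀ y ∈ G, 0 ≤ l y) → 0 ≤ l g → 0 ≤ l x := by
        intro l hl hg
        have h1 : AddSubmonoid.closure (insert g G) ≤
            (AddSubmonoid.nonneg ℤ).comap l :=
          AddSubmonoid.closure_le.2 (Set.insert_subset hg fun y hy => hl y hy)
        have h2 : 0 ≤ l (k • x) := h1 hx
        rw [map_nsmul, nsmul_eq_mul] at h2
        exact nonneg_of_mul_nonneg_right h2 (by exact_mod_cast hk)
      have hG : ∀ l ∈ L, ∀ y ∈ G, 0 ≤ l y := fun l hl y hy =>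
        (ih y).1 ⟨1, one_pos, by simpa using AddSubmonoid.subset_closure hy⟩ l hl
      rintro l (hl | ⟨a, ha, b, hb, rfl⟩)
      · exact hpos l (hG l hl.1) hl.2
      · refine hpos _ (fun y hy => ?_) ?_
        · have h1 := mul_nonneg ha.2 (hG b hb.1 y hy)
          have h2 := mul_nonneg (neg_nonneg.2 hb.2.le) (hG a ha.1 y hy)
          simp only [AddMonoidHom.sub_apply, AddMonoidHom.smul_apply, smul_eq_mul]
          linarith
        · simp [mul_comm]
    · obtain ⟨k, n, hk, hkn⟩ : ∃ k n : ℕ, 0 < k ∧ ∀ l ∈ L, 0 ≤ l (k • x - n • g) := by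
        by_cases hneg : ∀ l ∈ Q, 0 ≤ l x
        · refine ⟨1, 0, one_pos, fun l hl => ?_⟩
          rcases le_or_gt 0 (l g) with hg | hg
          · simpa using h l (Or.inl ⟨hl, hg⟩)
          · simpa using hneg l ⟨hl, hg⟩
        · push Not at hneg
          obtain ⟨l₁, hl₁, hx₁⟩ := hneg
          obtain ⟨l₀, hl₀, hmax⟩ := Q.exists_max_image (fun l => (l x : ℚ) / l g) hQ ⟨l₁, hl₁⟩
          have hg₀ : l₀ g < 0 := hl₀.2
          have hmul : ∀ l ∈ Q, l x * l₀ g ≤ l₀ x * l g := by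
            intro l hl
            have h1 : (l g : ℚ) < 0 := by exact_mod_cast hl.2
            have h2 : (l₀ g : ℚ) < 0 := by exact_mod_cast hl₀.2
            have h3 := mul_le_mul_of_nonneg_right (hmax l hl) (mul_pos_of_neg_of_neg h1 h2).le
            have h4 : (l x : ℚ) / l g * (l g * l₀ g) = l x * l₀ g := by
              rw [← mul_assoc, div_mul_cancel₀ _ h1.ne]
            have h5 : (l₀ x : ℚ) / l₀ g * (l g * l₀ g) = l₀ x * l g := by
              rw [mul_comm (l g : ℚ), ← mul_assoc, div_mul_cancel₀ _ h2.ne]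
            rw [h4, h5] at h3
            exact_mod_cast h3
          have hx₀ : l₀ x < 0 := by
            by_contra! hcon
            have h1 := hmul l₁ hl₁
            have h2 := mul_pos_of_neg_of_neg hx₁ hg₀
            have h3 := mul_nonpos_of_nonneg_of_nonpos hcon hl₁.2.le
            linarith
          -- The ratio n / k is the largest lower bound l x / l g over Q, attained at l₀. Both l₀ x
          -- and l₀ g are negative, so negating them gives natural numbers.
          refine ⟨(-l₀ g).toNat, (-l₀ x).toNat, by simpa using hg₀, fun l hl => ?_⟩
          have hk : (((-l₀ g).toNat : ℕ) : ℤ) = -l₀ g := Int.toNat_of_nonneg (by linarith)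
          have hn : (((-l₀ x).toNat : ℕ) : ℤ) = -l₀ x := Int.toNat_of_nonneg (by linarith)
          rw [map_sub, map_nsmul, map_nsmul, nsmul_eq_mul, nsmul_eq_mul, hk, hn]
          rcases le_or_gt 0 (l g) with hg | hg
          · have := h _ (Or.inr ⟨l, ⟨hl, hg⟩, l₀, hl₀, rfl⟩)
            simp only [AddMonoidHom.sub_apply, AddMonoidHom.smul_apply, smul_eq_mul] at this
            linarith
          · linarith [hmul l ⟨hl, hg⟩]
      obtain ⟨j, hj, hmem⟩ := (ih _).2 hkn
      refine ⟨j * k, mul_pos hj hk, ?_⟩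
      have : (j * k) • x = j • (k • x - n • g) + (j * n) • g := by
        rw [smul_sub, mul_smul, mul_smul, sub_add_cancel]
      rw [this]
      exact add_mem (AddSubmonoid.closure_mono (Set.subset_insert _ _) hmem)
        (nsmul_mem (AddSubmonoid.subset_closure (Set.mem_insert _ _)) _)

/-- Gordan's lemma for a cone given by finitely many linear inequalities. -/
theorem fg_of_dual {L : Set (N →+ ℤ)} (hL : L.Finite) {S : AddSubmonoid N}
    (hS : ∀ x, x ∈ S ↔ ∀ l ∈ L, 0 ≤ l x) : S.FG := by
  have := hL.to_subtype
  let F : N →+ (L → ℤ) := AddMonoidHom.pi fun l => l.1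
  let c : (L → ℕ) →+ (L → ℤ) := AddMonoidHom.pi fun l =>
    (Nat.castAddMonoidHom ℤ).comp (Pi.evalAddMonoidHom (fun _ : L => ℕ) l)
  -- Natural vectors in the image of F are closed under those differences that stay in ℕ^L, hence
  -- finitely generated. Lifts of their generators, together with ker F, generate S.
  let P : AddSubmonoid (L → ℕ) := (AddMonoidHom.mrange F).comap c
  have hP : P.FG := by
    refine AddSubmonoid.fg_of_subtractive ?_
    rintro x ⟨a, ha⟩ y ⟨b, hb⟩
    exact ⟨b - a, by rw [map_sub, ha, hb, map_add, add_sub_cancel_left]⟩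
  obtain ⟨T, hT⟩ := hP
  have hlift : ∀ y ∈ P, ∃ x, F x = c y := fun y hy => hy
  choose! s hs using hlift
  have hker : F.ker.toAddSubmonoid.FG := by
    rw [← AddSubgroup.fg_iff_addSubmonoid_fg]
    exact (Submodule.fg_iff_addSubgroup_fg (AddSubgroup.toIntSubmodule F.ker)).1
      (IsNoetherian.noetherian _)
  have hTP : ∀ y ∈ T, y ∈ P := fun y hy => hT ▸ AddSubmonoid.subset_closure hy
  have hfg : (AddSubmonoid.closure (s '' (T : Set (L → ℕ))) ⊔ F.ker.toAddSubmonoid).FG :=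
    AddSubmonoid.FG.sup ((AddSubmonoid.fg_iff _).2 ⟨_, rfl, T.finite_toSet.image _⟩) hker
  convert hfg
  apply le_antisymm
  · intro x hx
    have hy : ∃ y : L → ℕ, c y = F x :=
      ⟨fun l => (l.1 x).toNat, funext fun l =>
        Int.toNat_of_nonneg ((hS x).1 hx l l.2)⟩
    obtain ⟨y, hy⟩ := hy
    have hyP : y ∈ P := ⟨x, hy.symm⟩
    have h2 : ∃ z ∈ AddSubmonoid.closure (s '' (T : Set (L → ℕ))), F z = c y := by
      clear hy
      rw [← hT] at hyP
      induction hyP using AddSubmonoid.closure_induction with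
      | mem y hy' => exact ⟨s y, AddSubmonoid.subset_closure ⟨y, hy', rfl⟩, hs y (hTP y hy')⟩
      | zero => exact ⟨0, zero_mem _, by simp⟩
      | add a b _ _ iha ihb =>
        obtain ⟨z, hz, hz'⟩ := iha
        obtain ⟨z', hw, hw'⟩ := ihb
        exact ⟨z + z', add_mem hz hw, by rw [map_add, map_add, hz', hw']⟩
    obtain ⟨z, hz, hzy⟩ := h2
    rw [← add_sub_cancel z x]
    refine add_mem (AddSubmonoid.mem_sup_left hz) (AddSubmonoid.mem_sup_right ?_)
    change F (x - z) = 0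
    rw [map_sub, hzy, hy, sub_self]
  · refine sup_le (AddSubmonoid.closure_le.2 ?_) fun x hx => (hS x).2 fun l hl => ?_
    · rintro _ ⟨y, hy, rfl⟩
      refine (hS _).2 fun l hl => ?_
      have := congrFun (hs y (hTP y hy)) ⟨l, hl⟩
      change l (s y) = (y ⟨l, hl⟩ : ℤ) at this
      simp [this]
    · exact (congrFun (show F x = 0 from hx) ⟨l, hl⟩).ge

end Weyl

/-! ### Monomial valuations and integral closure -/

section SemigroupRing

variable {k : Type*} [Field k] {S : Type*} [AddCommMonoid S]

theorem exists_add_of_coeff_mul_ne_zero {f g : AddMonoidAlgebra k S} {s : S}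
    (h : (f * g).coeff s ≠ 0) : ∃ a b, f.coeff a ≠ 0 ∧ g.coeff b ≠ 0 ∧ a + b = s := by
  classical
  contrapose! h
  rw [AddMonoidAlgebra.coeff_mul]
  refine Finset.sum_eq_zero fun a ha => Finset.sum_eq_zero fun b hb => ?_
  exact if_neg (h a b (Finsupp.mem_support_iff.1 ha) (Finsupp.mem_support_iff.1 hb))

/-- The elements of `k[S]` all of whose exponents `u` satisfy `b ≤ l u`. -/
def supportGE (k : Type*) [Field k] (l : S →+ ℤ) (b : ℤ) : AddSubgroup (AddMonoidAlgebra k S) where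
  carrier := {f | ∀ u, f.coeff u ≠ 0 → b ≤ l u}
  zero_mem' := by simp
  add_mem' := by
    intro f g hf hg u hu
    by_cases h : f.coeff u = 0
    · exact hg u (by simpa [h] using hu)
    · exact hf u h
  neg_mem' := by
    intro f hf u hu
    exact hf u (by simpa using hu)

theorem mem_supportGE {l : S →+ ℤ} {b : ℤ} {f : AddMonoidAlgebra k S} :
    f ∈ supportGE k l b ↔ ∀ u, f.coeff u ≠ 0 → b ≤ l u := Iff.rfl

theorem supportGE_anti {l : S →+ ℤ} {b c : ℤ} (h : c ≤ b) : supportGE k l b ≤ supportGE k l c :=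
  fun _ hf u hu => h.trans (hf u hu)

theorem mul_mem_supportGE {l : S →+ ℤ} {b c : ℤ} {f g : AddMonoidAlgebra k S}
    (hf : f ∈ supportGE k l b) (hg : g ∈ supportGE k l c) : f * g ∈ supportGE k l (b + c) := by
  intro u hu
  obtain ⟨x, y, hx, hy, rfl⟩ := exists_add_of_coeff_mul_ne_zero hu
  rw [map_add]
  exact add_le_add (hf x hx) (hg y hy)

theorem one_mem_supportGE (l : S →+ ℤ) : (1 : AddMonoidAlgebra k S) ∈ supportGE k l 0 := by
  intro u hu
  rw [AddMonoidAlgebra.one_def, AddMonoidAlgebra.coeff_single] at hu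
  obtain rfl : u = 0 := by
    by_contra h
    exact hu (Finsupp.single_eq_of_ne h)
  simp

theorem pow_mem_supportGE {l : S →+ ℤ} {b : ℤ} {f : AddMonoidAlgebra k S}
    (hf : f ∈ supportGE k l b) (n : ℕ) : f ^ n ∈ supportGE k l (n * b) := by
  induction n with
  | zero => simpa using one_mem_supportGE l
  | succ n ih =>
    rw [pow_succ, Nat.cast_succ, add_one_mul]
    exact mul_mem_supportGE ih hf

theorem pow_sub_pow_mem_supportGE {l : S →+ ℤ} {b : ℤ} {f g : AddMonoidAlgebra k S}
    (hf : f ∈ supportGE k l b) (hg : g ∈ supportGE k l b) (hfg : f - g ∈ supportGE k l (b + 1))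
    (n : ℕ) : f ^ n - g ^ n ∈ supportGE k l (n * b + 1) := by
  induction n with
  | zero => simp
  | succ n ih =>
    have h1 : f ^ (n + 1) - g ^ (n + 1) = f ^ n * (f - g) + (f ^ n - g ^ n) * g := by ring
    rw [h1]
    refine add_mem (supportGE_anti ?_ (mul_mem_supportGE (pow_mem_supportGE hf n) hfg))
      (supportGE_anti ?_ (mul_mem_supportGE ih hg)) <;> push_cast <;> linarith

theorem ideal_pow_le_supportGE {l : S →+ ℤ} (hl : ∀ s, 0 ≤ l s) {b : ℤ}
    {J : Ideal (AddMonoidAlgebra k S)} (hJ : ∀ f ∈ J, f ∈ supportGE k l b) (n : ℕ) :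
    ∀ f ∈ J ^ n, f ∈ supportGE k l (n * b) := by
  induction n with
  | zero => intro f _ u _; simpa using hl u
  | succ n ih =>
    intro f hf
    rw [pow_succ] at hf
    induction hf using Submodule.mul_induction_on' with
    | mem_mul_mem x hx y hy =>
      rw [Nat.cast_succ, add_one_mul]
      exact mul_mem_supportGE (ih x hx) (hJ y hy)
    | add x _ y _ hx hy => exact add_mem hx hy

/-- A monomial valuation that is at least `b` on an ideal is at least `b` on its integral
closure. -/
theorem mem_supportGE_of_isIntegralOverIdeal [IsDomain (AddMonoidAlgebra k S)] {l : S →+ ℤ}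
    (hl : ∀ s, 0 ≤ l s) {b : ℤ} {J : Ideal (AddMonoidAlgebra k S)}
    (hJ : ∀ f ∈ J, f ∈ supportGE k l b) {f : AddMonoidAlgebra k S}
    (hf : IsIntegralOverIdeal J f) : f ∈ supportGE k l b := by
  classical
  intro u hu
  obtain ⟨u₀, hu₀, hmin⟩ := f.coeff.support.exists_min_image l ⟨u, Finsupp.mem_support_iff.2 hu⟩
  refine le_trans ?_ (hmin u (Finsupp.mem_support_iff.2 hu))
  by_contra! hlt
  obtain ⟨q, hq, hx, hc⟩ := hf
  set c := l u₀ with hcdef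
  set n := q.natDegree
  have hfc : f ∈ supportGE k l c := fun v hv => hmin v (Finsupp.mem_support_iff.2 hv)
  -- Integral dependence expresses f^n through terms of value at least (n - i) b + i c with i < n;
  -- since c < b, this exceeds n c.
  have hfn : f ^ n ∈ supportGE k l (n * c + 1) := by
    rw [Polynomial.eval_eq_sum_range, Finset.sum_range_succ, hq.coeff_natDegree, one_mul] at hx
    rw [← neg_eq_of_add_eq_zero_right hx]
    refine neg_mem (sum_mem fun i hi => ?_)
    have hi' : i + 1 ≤ n := Finset.mem_range.1 hi
    refine supportGE_anti ?_ (mul_mem_supportGE (ideal_pow_le_supportGE hl hJ _ _ (hc i))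
      (pow_mem_supportGE hfc i))
    obtain ⟨j, hj⟩ := Nat.exists_eq_add_of_le hi'
    rw [hj, show i + 1 + j - i = j + 1 by omega]
    push_cast
    nlinarith
  let f₀ : AddMonoidAlgebra k S := .ofCoeff (f.coeff.filter fun v => l v = c)
  have hf₀ : ∀ v, f₀.coeff v = if l v = c then f.coeff v else 0 := fun v =>
    Finsupp.filter_apply _ _ _
  have hf₀c : f₀ ∈ supportGE k l c := by
    intro v hv
    rw [hf₀] at hv
    exact (of_not_not fun h => hv (if_neg h)).ge
  have hf₀c' : f₀ ∈ supportGE k (-l) (-c) := by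
    intro v hv
    rw [hf₀] at hv
    exact neg_le_neg (of_not_not fun h => hv (if_neg h)).le
  have hsub : f - f₀ ∈ supportGE k l (c + 1) := by
    intro v hv
    rw [AddMonoidAlgebra.coeff_sub, Finsupp.sub_apply, hf₀] at hv
    split_ifs at hv with h
    · simp at hv
    · exact lt_of_le_of_ne (hfc v (by simpa using hv)) (Ne.symm h)
  -- The initial form f₀ has f₀^n homogeneous of degree n c, yet f₀^n differs from f^n only in
  -- degrees above n c, where f^n lives entirely.
  have h0 : f₀ ^ n = 0 := by
    have h1 : f₀ ^ n ∈ supportGE k l (n * c + 1) := by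
      rw [← sub_sub_cancel (f ^ n) (f₀ ^ n)]
      exact sub_mem hfn (pow_sub_pow_mem_supportGE hfc hf₀c hsub n)
    have h2 := pow_mem_supportGE hf₀c' n
    ext v
    by_contra hv
    have h3 := h1 v hv
    have h4 := h2 v hv
    simp only [AddMonoidHom.neg_apply] at h4
    linarith
  have h5 : f₀.coeff u₀ = 0 := by rw [eq_zero_of_pow_eq_zero h0]; simp
  rw [hf₀, if_pos hcdef.symm] at h5
  exact Finsupp.mem_support_iff.1 hu₀ h5

/-- The monomial is a root of X^n - x^(n s). -/
theorem single_mem_idealIntegralClosure {J : Ideal (AddMonoidAlgebra k S)} {n : ℕ} (hn : n ≠ 0)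
    {s : S} (h : AddMonoidAlgebra.single (n • s) (1 : k) ∈ J ^ n) :
    AddMonoidAlgebra.single s (1 : k) ∈ idealIntegralClosure J := by
  refine ⟨Polynomial.X ^ n - Polynomial.C (AddMonoidAlgebra.single (n • s) (1 : k)),
    Polynomial.monic_X_pow_sub_C _ hn, ?_, fun i => ?_⟩
  · simp [AddMonoidAlgebra.single_pow]
  · rw [Polynomial.natDegree_X_pow_sub_C]
    rw [Polynomial.coeff_sub, Polynomial.coeff_X_pow, Polynomial.coeff_C]
    by_cases hi : i = n
    · subst hi; simp
    · rw [if_neg hi]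
      split_ifs with h0
      · subst h0
        simpa using neg_mem h
      · simp

end SemigroupRing

/-! ### Lattice points of a rational cone -/

section Cone

variable {M : Type*} [AddCommGroup M]

/-- The real extension of an integral linear form. -/
def realExtension (l : M →+ ℤ) : ℝ ⊗[ℤ] M →ₗ[ℝ] ℝ :=
  (TensorProduct.AlgebraTensorModule.rid ℤ ℝ ℝ).toLinearMap ∘ₗ l.toIntLinearMap.baseChange ℝ

theorem realExtension_tmul (l : M →+ ℤ) (m : M) :
    realExtension l ((1 : ℝ) ⊗ₜ[ℤ] m) = l m := by
  simp [realExtension]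

theorem mem_latticePoints {σ : PointedCone ℝ (ℝ ⊗[ℤ] M)} {m : M} :
    m ∈ latticePoints σ ↔ (1 : ℝ) ⊗ₜ[ℤ] m ∈ σ := Iff.rfl

theorem mem_latticePoints_of_nsmul {σ : PointedCone ℝ (ℝ ⊗[ℤ] M)} {m : M} {n : ℕ} (hn : 0 < n)
    (h : n • m ∈ latticePoints σ) : m ∈ latticePoints σ := by
  rw [mem_latticePoints, ← TensorProduct.mk_apply, map_nsmul, TensorProduct.mk_apply] at h
  have h1 := σ.smul_mem (by positivity : 0 ≤ (n : ℝ)⁻¹) h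
  rwa [← Nat.cast_smul_eq_nsmul ℝ, smul_smul, inv_mul_cancel₀ (by positivity), one_smul] at h1

/-- Integral forms nonnegative on the generators extend to real forms nonnegative on σ, so by Weyl's
theorem a lattice point of the real cone is already a nonnegative rational combination of
generators. -/
theorem mem_latticePoints_iff [IsAddTorsionFree M] [Module.Finite ℤ M]
    {σ : PointedCone ℝ (ℝ ⊗[ℤ] M)} {s : Finset M}
    (hs : σ = PointedCone.hull ℝ ((fun m : M => (1 : ℝ) ⊗ₜ[ℤ] m) '' (s : Set M))) (m : M) :
    m ∈ latticePoints σ ↔ ∃ n : ℕ, 0 < n ∧ n • m ∈ AddSubmonoid.closure (s : Set M) := by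
  constructor
  · intro hm
    obtain ⟨L, -, hL⟩ := exists_finite_dual s.finite_toSet
    refine (hL m).2 fun l hl => ?_
    have key : ∀ x ∈ σ, 0 ≤ realExtension l x := by
      intro x hx
      rw [hs] at hx
      induction hx using Submodule.span_induction with
      | mem x hx =>
        obtain ⟨y, hy, rfl⟩ := hx
        rw [realExtension_tmul]
        exact_mod_cast (hL y).1 ⟨1, one_pos, by simpa using AddSubmonoid.subset_closure hy⟩ l hl
      | zero => simp
      | add x y _ _ hx hy => rw [map_add]; exact add_nonneg hx hy
      | smul c x _ hx =>
        change 0 ≤ realExtension l ((c : ℝ) • x)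
        rw [map_smul]
        exact mul_nonneg c.2 hx
    have := key _ hm
    rw [realExtension_tmul] at this
    exact_mod_cast this
  · rintro ⟨n, hn, h⟩
    refine mem_latticePoints_of_nsmul hn ?_
    refine (AddSubmonoid.closure_le (S := latticePoints σ)).2 (fun y hy => ?_) h
    rw [SetLike.mem_coe, mem_latticePoints, hs]
    exact Submodule.subset_span ⟨y, hy, rfl⟩

/-- Gordan's lemma. -/
theorem IsRationalPolyhedral.fg_latticePoints [IsAddTorsionFree M] [Module.Finite ℤ M]
    {σ : PointedCone ℝ (ℝ ⊗[ℤ] M)} (hσ : IsRationalPolyhedral σ) : (latticePoints σ).FG := by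
  obtain ⟨s, hs⟩ := hσ
  obtain ⟨L, hL, h⟩ := exists_finite_dual s.finite_toSet
  exact fg_of_dual hL fun x => (mem_latticePoints_iff hs x).trans (h x)

end Cone

/-! ### The cone over the Newton polyhedron -/

section MonomialIdeal

variable {k : Type*} [Field k] {M : Type*} [AddCommGroup M] [IsAddTorsionFree M]
  [Module.Finite ℤ M] {σ : PointedCone ℝ (ℝ ⊗[ℤ] M)}

theorem isNoetherianRing_semigroupRing (hσ : IsRationalPolyhedral σ) :
    IsNoetherianRing (AddMonoidAlgebra k (latticePoints σ)) := by
  have : AddMonoid.FG (latticePoints σ) :=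
    (AddMonoid.fg_iff_addSubmonoid_fg _).2 hσ.fg_latticePoints
  exact Algebra.FiniteType.isNoetherianRing k _

theorem isDomain_semigroupRing (σ : PointedCone ℝ (ℝ ⊗[ℤ] M)) :
    IsDomain (AddMonoidAlgebra k (latticePoints σ)) := by
  have : AddMonoid.FG M := AddGroup.fg_iff_addMonoid_fg.1 (Module.Finite.iff_addGroup_fg.1 inferInstance)
  have : TwoUniqueSums (latticePoints σ) := .of_injective_addHom
    (latticePoints σ).subtype.toAddHom Subtype.val_injective inferInstance
  infer_instance

/-- The integral closures of all powers of a monomial ideal are spanned by the monomials in the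
slices of a cone in `M × ℤ` given by finitely many inequalities. -/
theorem exists_dual_integralClosure (hσ : IsRationalPolyhedral σ)
    {𝔞 : Ideal (AddMonoidAlgebra k (latticePoints σ))} (h𝔞 : IsMonomialIdeal 𝔞) :
    ∃ L : Set (M × ℤ →+ ℤ), L.Finite ∧ (∀ l ∈ L, ∀ s ∈ latticePoints σ, 0 ≤ l (s, 0)) ∧
      ∀ m : ℕ, (∀ f ∈ idealIntegralClosure (𝔞 ^ m), ∀ u : latticePoints σ, f.coeff u ≠ 0 →
          ∀ l ∈ L, 0 ≤ l (u, m)) ∧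
        ∀ u : M, (∀ l ∈ L, 0 ≤ l (u, m)) → ∃ h : u ∈ latticePoints σ,
          AddMonoidAlgebra.single ⟨u, h⟩ (1 : k) ∈ idealIntegralClosure (𝔞 ^ m) := by
  classical
  have := isNoetherianRing_semigroupRing (k := k) hσ
  have := isDomain_semigroupRing (k := k) σ
  obtain ⟨A', hA'⟩ := h𝔞
  obtain ⟨B, hBA, hB⟩ := (Submodule.fg_span_iff_fg_span_finset_subset _).1
    (hA' ▸ IsNoetherian.noetherian 𝔞)
  have h𝔞B : 𝔞 = Ideal.span (B : Set (AddMonoidAlgebra k (latticePoints σ))) := hA'.trans hB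
  obtain ⟨A, hAA', rfl⟩ := Finset.subset_set_image_iff.1 hBA
  obtain ⟨s, hs⟩ := hσ
  let G : Set (M × ℤ) := (fun a : latticePoints σ => ((a : M), (1 : ℤ))) '' A ∪
    (fun a : M => (a, (0 : ℤ))) '' s
  have hG : G.Finite := (A.finite_toSet.image _).union (s.finite_toSet.image _)
  obtain ⟨L, hL, hLG⟩ := exists_finite_dual hG
  have hLg : ∀ l ∈ L, ∀ g ∈ G, 0 ≤ l g := fun l hl g hg =>
    (hLG g).1 ⟨1, one_pos, by simpa using AddSubmonoid.subset_closure hg⟩ l hl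
  have hLS : ∀ l ∈ L, ∀ x ∈ latticePoints σ, 0 ≤ l (x, 0) := by
    intro l hl x hx
    obtain ⟨n, hn, hx⟩ := (mem_latticePoints_iff hs x).1 hx
    refine (hLG (x, 0)).1 ⟨n, hn, ?_⟩ l hl
    have h1 : AddSubmonoid.closure (s : Set M) ≤
        (AddSubmonoid.closure G).comap (AddMonoidHom.inl M ℤ) :=
      AddSubmonoid.closure_le.2 fun y hy => AddSubmonoid.subset_closure (Or.inr ⟨y, hy, rfl⟩)
    simpa using h1 hx
  have hsplit : ∀ (l : M × ℤ →+ ℤ) (u : M) (m : ℕ), l (u, (m : ℤ)) = l (u, 0) + m * l (0, 1) := by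
    intro l u m
    have : (u, (m : ℤ)) = (u, (0 : ℤ)) + m • ((0 : M), (1 : ℤ)) := by simp
    rw [this, map_add, map_nsmul, nsmul_eq_mul]
  refine ⟨L, hL, hLS, fun m => ⟨fun f hf u hu l hl => ?_, fun u hu => ?_⟩⟩
  -- The monomial valuation u ↦ l (u, 0) is at least -l (0, 1) on 𝔞, hence at least -m l (0, 1) on
  -- the integral closure of 𝔞^m.
  · let l' : latticePoints σ →+ ℤ := (l.comp (AddMonoidHom.inl M ℤ)).comp (latticePoints σ).subtype
    have hl' : ∀ x : latticePoints σ, l' x = l (x, 0) := fun x => rfl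
    have hpos : ∀ x, 0 ≤ l' x := fun x => hLS l hl x x.2
    have h1 : ∀ f ∈ 𝔞, f ∈ supportGE k l' (-l (0, 1)) := by
      intro f hf
      rw [h𝔞B] at hf
      induction hf using Submodule.span_induction with
      | mem f hf =>
        rw [Finset.coe_image] at hf
        obtain ⟨a, ha, rfl⟩ := hf
        intro v hv
        have h2 := hLg l hl _ (Or.inl ⟨a, ha, rfl⟩)
        have h3 := hsplit l a 1
        rw [AddMonoidAlgebra.coeff_single] at hv
        obtain rfl : v = a := by
          by_contra h
          exact hv (Finsupp.single_eq_of_ne h)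
        rw [hl']
        push_cast at h3
        linarith
      | zero => exact zero_mem _
      | add f g _ _ hf hg => exact add_mem hf hg
      | smul r f _ hf =>
        rw [smul_eq_mul, ← zero_add (-l (0, 1))]
        exact mul_mem_supportGE (fun v _ => hpos v) hf
    have h2 := mem_supportGE_of_isIntegralOverIdeal hpos (ideal_pow_le_supportGE hpos h1 m) hf u hu
    rw [hl'] at h2
    rw [hsplit]
    linarith
  · obtain ⟨n, hn, hmem⟩ := (hLG _).2 hu
    -- The height counts factors from 𝔞. Only a multiple n (u, m) need lie in the monoid, which
    -- gives x^(n u) ∈ 𝔞^(m n); its n-th root x^u is integral over 𝔞^m.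
    have key : ∀ x ∈ AddSubmonoid.closure G, ∃ (h : x.1 ∈ latticePoints σ) (j : ℕ), x.2 = j ∧
        AddMonoidAlgebra.single ⟨x.1, h⟩ (1 : k) ∈ 𝔞 ^ j := by
      intro x hx
      induction hx using AddSubmonoid.closure_induction with
      | mem x hx =>
        rcases hx with ⟨a, ha, rfl⟩ | ⟨a, ha, rfl⟩
        · refine ⟨a.2, 1, by simp, ?_⟩
          rw [pow_one, h𝔞B]
          refine Ideal.subset_span ?_
          rw [Finset.coe_image]
          exact ⟨a, ha, rfl⟩
        · exact ⟨(mem_latticePoints_iff hs a).2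
            ⟨1, one_pos, by simpa using AddSubmonoid.subset_closure ha⟩, 0, by simp, by simp⟩
      | zero => exact ⟨zero_mem _, 0, by simp, by simp⟩
      | add x y _ _ hx hy =>
        obtain ⟨h1, i, hi, hi'⟩ := hx
        obtain ⟨h2, j, hj, hj'⟩ := hy
        refine ⟨add_mem h1 h2, i + j, by simp [hi, hj], ?_⟩
        rw [pow_add]
        have := Ideal.mul_mem_mul hi' hj'
        rwa [AddMonoidAlgebra.single_mul_single, one_mul] at this
    obtain ⟨h, j, hj, hj'⟩ := key _ hmem
    have hu' : u ∈ latticePoints σ := mem_latticePoints_of_nsmul hn h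
    refine ⟨hu', single_mem_idealIntegralClosure hn.ne' ?_⟩
    rw [← pow_mul]
    have hjm : j = m * n := by
      have : (n : ℤ) * m = j := by simpa using hj
      rw [mul_comm]
      exact_mod_cast this.symm
    rw [← hjm]
    exact hj'

end MonomialIdeal

/-! ### Iterates of a toric map on coefficients -/

section ToricMap

variable {k : Type*} [Field k] {M : Type*} [AddCommGroup M] {S : AddSubmonoid M}

theorem coeff_inclusion (f : AddMonoidAlgebra k S) (s : S) :
    (inclusion k S f).coeff s = f.coeff s :=
  Finsupp.mapDomain_apply Subtype.val_injective _ _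

theorem mem_of_coeff_inclusion_ne_zero {f : AddMonoidAlgebra k S} {u : M}
    (h : (inclusion k S f).coeff u ≠ 0) : u ∈ S := by
  by_contra hu
  exact h (Finsupp.mapDomain_of_notMem_range _ _ (by simpa using hu))

theorem coeff_inclusion_single_mul (a : S) (c : k) (f : AddMonoidAlgebra k S) (u : M) :
    (inclusion k S (AddMonoidAlgebra.single a c * f)).coeff u =
      c * (inclusion k S f).coeff (u - a) := by
  rw [map_mul]
  have : inclusion k S (AddMonoidAlgebra.single a c) = AddMonoidAlgebra.single (a : M) c :=
    AddMonoidAlgebra.mapDomain_single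
  rw [this, AddMonoidAlgebra.coeff_single_mul_apply, neg_add_eq_sub]

/-- The `n`-th iterate of a toric map divides `u - twist p e w n` by `p ^ (n e)`. -/
def twist (p e : ℕ) (w : M) (n : ℕ) : M := (∑ i ∈ Finset.range n, (p ^ e) ^ i) • w

theorem twist_add (p e : ℕ) (w : M) (m n : ℕ) :
    twist p e w (m + n) = (p ^ e) ^ m • twist p e w n + twist p e w m := by
  rw [twist, twist, twist, Finset.sum_range_add, add_smul, smul_smul, Finset.mul_sum, add_comm]
  simp only [pow_add]

variable [IsAddTorsionFree M] {p : ℕ} [Fact p.Prime] {e : ℕ} {κ : k →+ k} {w : M}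
  {φ : AddMonoid.End (AddMonoidAlgebra k S)}

theorem IsToricMap.coeff_apply (hφ : IsToricMap p e κ w φ) (f : AddMonoidAlgebra k S) (v : M) :
    (inclusion k S (φ f)).coeff v = κ ((inclusion k S f).coeff (p ^ e • v + w)) := by
  rw [hφ f]
  simp [canonicalSplitting, AddMonoidAlgebra.coeff_single_mul_apply, add_comm]

theorem IsToricMap.coeff_pow_apply (hφ : IsToricMap p e κ w φ) (n : ℕ) (f : AddMonoidAlgebra k S)
    (v : M) : (inclusion k S ((φ ^ n) f)).coeff v =
      κ^[n] ((inclusion k S f).coeff ((p ^ e) ^ n • v + twist p e w n)) := by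
  induction n generalizing v with
  | zero => simp [twist]
  | succ n ih =>
    rw [pow_succ', AddMonoid.End.coe_mul, Function.comp_apply, hφ.coeff_apply, ih, Function.iterate_succ_apply',
      twist_add p e w n 1]
    congr 3
    simp [twist, smul_add, smul_smul, pow_succ, add_assoc]

/-- A nonzero lattice vector is not divisible by large powers of q. This lets φ^n separate the terms
of a generator. -/
theorem exists_forall_ne_add_smul [Module.Finite ℤ M] {q : ℕ} (hq : 2 ≤ q) (U : Set M)
    (hU : U.Finite) : ∃ N : ℕ, ∀ n, N ≤ n → ∀ u ∈ U, ∀ u' ∈ U, ∀ v : M, u' = u + q ^ n • v → v = 0 := by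
  let b := Module.Free.chooseBasis ℤ M
  have hfin : (Set.image2 (fun u u' => ∑ i, (b.repr (u' - u) i).natAbs) U U).Finite :=
    hU.image2 _ hU
  -- N bounds the ℓ¹-norms of the differences; n < q^n then suffices.
  obtain ⟨N, hN⟩ := hfin.bddAbove
  refine ⟨N, fun n hn u hu u' hu' v hv => ?_⟩
  rw [← b.repr.map_eq_zero_iff]
  ext i
  by_contra hi
  have h1 : ∑ i, (b.repr (u' - u) i).natAbs ≤ N := hN ⟨u, hu, u', hu', rfl⟩
  have h2 : (b.repr (u' - u) i).natAbs ≤ ∑ i, (b.repr (u' - u) i).natAbs :=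
    Finset.single_le_sum (f := fun i => (b.repr (u' - u) i).natAbs) (fun _ _ => zero_le)
      (Finset.mem_univ i)
  have h3 : (b.repr (u' - u) i).natAbs = q ^ n * (b.repr v i).natAbs := by
    rw [hv, add_sub_cancel_left, map_nsmul]
    simp [Int.natAbs_mul, Int.natAbs_pow]
  have h4 : 1 ≤ (b.repr v i).natAbs := Int.natAbs_pos.2 hi
  have h5 : n < q ^ n := Nat.lt_pow_self hq
  have h6 : q ^ n * 1 ≤ q ^ n * (b.repr v i).natAbs := Nat.mul_le_mul_left _ h4
  omega

end ToricMap

/-! ### Exponents of an ideal -/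

section Exponents

variable {k : Type*} [Field k] {M : Type*} [AddCommGroup M] {S : AddSubmonoid M}

/-- The exponents of the monomials that occur in the elements of an ideal. -/
def exponents (I : Ideal (AddMonoidAlgebra k S)) : Set M :=
  {v | ∃ f ∈ I, (inclusion k S f).coeff v ≠ 0}

/-- Only J has to be monomial. Used in both directions, this recovers a fixed ideal from its
exponents. -/
theorem ideal_le_of_exponents_subset {I J : Ideal (AddMonoidAlgebra k S)}
    (h : exponents I ⊆ exponents J)
    (hJ : ∀ v ∈ exponents J, ∃ hv : v ∈ S, AddMonoidAlgebra.single ⟨v, hv⟩ (1 : k) ∈ J) :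
    I ≤ J := by
  intro f hf
  have hsum : f = f.coeff.sum fun s c => AddMonoidAlgebra.single s c :=
    (AddMonoidAlgebra.sum_coeff_single f).symm
  rw [hsum]
  refine sum_mem fun s hs => ?_
  obtain ⟨hv, hmem⟩ := hJ s (h ⟨f, hf, by rw [coeff_inclusion]; exact Finsupp.mem_support_iff.1 hs⟩)
  have := J.mul_mem_left (AddMonoidAlgebra.single 0 (f.coeff s)) hmem
  rwa [AddMonoidAlgebra.single_mul_single, zero_add, mul_one] at this

theorem exists_finset_generators [IsNoetherianRing (AddMonoidAlgebra k S)]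
    (I : Ideal (AddMonoidAlgebra k S)) : ∃ T : Finset (AddMonoidAlgebra k S),
      (∀ f ∈ T, f ∈ I) ∧
      ∀ v ∈ exponents I, ∃ f ∈ T, ∃ s ∈ S, ∃ u, (inclusion k S f).coeff u ≠ 0 ∧ v = s + u := by
  obtain ⟨T, hT⟩ := IsNoetherian.noetherian I
  refine ⟨T, fun f hf => hT ▸ Submodule.subset_span hf, ?_⟩
  rintro v ⟨g, hg, hv⟩
  rw [← hT] at hg
  induction hg using Submodule.span_induction generalizing v with
  | mem f hf => exact ⟨f, hf, 0, zero_mem _, v, hv, (zero_add v).symm⟩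
  | zero => simp at hv
  | add f g _ _ hf hg =>
    by_cases h : (inclusion k S f).coeff v = 0
    · exact hg v (by simpa [h] using hv)
    · exact hf v h
  | smul r f _ hf =>
    rw [smul_eq_mul, map_mul] at hv
    obtain ⟨a, b, ha, hb, rfl⟩ := exists_add_of_coeff_mul_ne_zero hv
    obtain ⟨f', hf', s, hs, u, hu, rfl⟩ := hf b hb
    exact ⟨f', hf', a + s, add_mem (mem_of_coeff_inclusion_ne_zero ha) hs, u, hu,
      (add_assoc _ _ _).symm⟩

end Exponents

/-! ### Consequences of the fixed-point equation -/

section Fixed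

variable {p : ℕ} [Fact p.Prime] {k : Type*} [Field k] {M : Type*} [AddCommGroup M]
  [IsAddTorsionFree M] {S : AddSubmonoid M} {e : ℕ} {κ : k →+ k} {w : M}
  {φ : AddMonoid.End (AddMonoidAlgebra k S)} {𝔞 : Ideal (AddMonoidAlgebra k S)} {t : ℚ}
  {L : Set (M × ℤ →+ ℤ)} {I : Ideal (AddMonoidAlgebra k S)}

theorem IsCartierFixed.exists_step (hφ : IsToricMap p e κ w φ)
    (hL : ∀ m : ℕ, ∀ f ∈ idealIntegralClosure (𝔞 ^ m), ∀ u : S, f.coeff u ≠ 0 →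
      ∀ l ∈ L, 0 ≤ l (u, m))
    (hI : IsCartierFixed p e φ 𝔞 t I) {v : M} (hv : v ∈ exponents I) :
    ∃ n m : ℕ, (0 < n ∧ (m : ℚ) = t * ((p : ℚ) ^ (n * e) - 1)) ∧ ∃ a : M,
      (∀ l ∈ L, 0 ≤ l (a, m)) ∧ ∃ u ∈ exponents I, (p ^ e) ^ n • v + twist p e w n = a + u := by
  obtain ⟨f, hf, hv⟩ := hv
  by_contra! hcon
  -- The functional c reads off the coefficient at v. Without a decomposition of the required kind,
  -- it would vanish on every summand, hence on I.
  let c : AddMonoidAlgebra k S →+ k := (Finsupp.applyAddHom v).comp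
    ((AddMonoidAlgebra.coeffAddEquiv (R := k) (M := M)).toAddMonoidHom.comp
      (inclusion k S).toAddMonoidHom)
  have hc : ∀ g, c g = (inclusion k S g).coeff v := fun g => rfl
  have hle : cartierSum p e φ 𝔞 t I ≤ c.ker := by
    refine iSup_le fun n => iSup_le fun m => iSup_le fun hnm => ?_
    rintro _ ⟨g, hg, rfl⟩
    rw [AddMonoidHom.mem_ker, hc]
    by_contra hne
    change (inclusion k S ((φ ^ n) g)).coeff v ≠ 0 at hne
    rw [hφ.coeff_pow_apply] at hne
    have hne' : (inclusion k S g).coeff ((p ^ e) ^ n • v + twist p e w n) ≠ 0 := by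
      intro h0
      rw [h0] at hne
      exact hne (iterate_map_zero κ n)
    clear hne
    change g ∈ idealIntegralClosure (𝔞 ^ m) * I at hg
    induction hg using Submodule.mul_induction_on' with
    | mem_mul_mem j hj i hi =>
      rw [map_mul] at hne'
      obtain ⟨a, u, ha, hu, hau⟩ := exists_add_of_coeff_mul_ne_zero hne'
      have haS := mem_of_coeff_inclusion_ne_zero ha
      refine hcon n m hnm a (hL m j hj ⟨a, haS⟩ ?_) u ⟨i, hi, hu⟩ hau.symm
      rwa [← coeff_inclusion]
    | add x _ y _ hx hy =>
      by_cases h : (inclusion k S x).coeff ((p ^ e) ^ n • v + twist p e w n) = 0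
      · exact hy (by simpa [h] using hne')
      · exact hx h
  refine hv (hle ?_)
  rw [show cartierSum p e φ 𝔞 t I = I.toAddSubgroup from hI]
  exact hf

/-- Applying the step again to u raises n by at least one. The relations compose because w_n and
t(q^n - 1) obey the same recursion and the cone is closed under addition. -/
theorem IsCartierFixed.exists_ge (hφ : IsToricMap p e κ w φ)
    (hL : ∀ m : ℕ, ∀ f ∈ idealIntegralClosure (𝔞 ^ m), ∀ u : S, f.coeff u ≠ 0 →
      ∀ l ∈ L, 0 ≤ l (u, m))
    (hI : IsCartierFixed p e φ 𝔞 t I) {v : M} (hv : v ∈ exponents I) (N : ℕ) :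
    ∃ n m : ℕ, N ≤ n ∧ (0 < n ∧ (m : ℚ) = t * ((p : ℚ) ^ (n * e) - 1)) ∧ ∃ a : M,
      (∀ l ∈ L, 0 ≤ l (a, m)) ∧ ∃ u ∈ exponents I, (p ^ e) ^ n • v + twist p e w n = a + u := by
  induction N with
  | zero =>
    obtain ⟨n, m, h⟩ := hI.exists_step hφ hL hv
    exact ⟨n, m, zero_le, h⟩
  | succ N ih =>
    obtain ⟨n, m, hNn, ⟨hn, hm⟩, a, ha, u, hu, hau⟩ := ih
    obtain ⟨n', m', ⟨hn', hm'⟩, a', ha', u', hu', hau'⟩ := hI.exists_step hφ hL hu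
    refine ⟨n' + n, (p ^ e) ^ n' * m + m', by omega, ⟨by omega, ?_⟩, (p ^ e) ^ n' • a + a', ?_, u',
      hu', ?_⟩
    · push_cast
      rw [hm, hm', add_mul, pow_add, ← pow_mul, mul_comm e n']
      ring
    · intro l hl
      have h1 : ((p ^ e) ^ n' • a + a', (((p ^ e) ^ n' * m + m' : ℕ) : ℤ)) =
          (p ^ e) ^ n' • (a, (m : ℤ)) + (a', (m' : ℤ)) := by
        simp
      rw [h1, map_add, map_nsmul]
      exact add_nonneg (nsmul_nonneg (ha l hl) _) (ha' l hl)
    · have h1 : (p ^ e) ^ n' • ((p ^ e) ^ n • v + twist p e w n) =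
          (p ^ e) ^ n' • a + (p ^ e) ^ n' • u := by rw [hau, smul_add]
      rw [smul_add, smul_smul, ← pow_add] at h1
      rw [twist_add, ← add_assoc, h1, add_assoc, hau', add_assoc]

theorem IsCartierFixed.single_mem (hφ : IsToricMap p e κ w φ) (hκ : κ 1 = 1)
    (hI : IsCartierFixed p e φ 𝔞 t I) {n m : ℕ}
    (hnm : 0 < n ∧ (m : ℚ) = t * ((p : ℚ) ^ (n * e) - 1)) {f : AddMonoidAlgebra k S} (hf : f ∈ I)
    {u v : M} (hu : (inclusion k S f).coeff u ≠ 0)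
    (hinj : ∀ u', (inclusion k S f).coeff u' ≠ 0 → ∀ x : M, u' = u + (p ^ e) ^ n • x → x = 0)
    (ha : ∃ h : (p ^ e) ^ n • v + twist p e w n - u ∈ S,
      AddMonoidAlgebra.single ⟨_, h⟩ (1 : k) ∈ idealIntegralClosure (𝔞 ^ m)) :
    ∃ hv : v ∈ S, AddMonoidAlgebra.single ⟨v, hv⟩ (1 : k) ∈ I := by
  classical
  obtain ⟨ha, hmem⟩ := ha
  set a : S := ⟨_, ha⟩
  set c := (inclusion k S f).coeff u
  -- The shift by a moves u to q^n v + w_n, so φ^n g has only the term at v. The coefficient is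
  -- normalised to 1 beforehand because κ fixes 1 but may kill other scalars.
  let g := AddMonoidAlgebra.single a (c⁻¹) * f
  have hg : g ∈ idealIntegralClosure (𝔞 ^ m) * I := by
    refine Ideal.mul_mem_mul ?_ hf
    have := Ideal.mul_mem_left _ (AddMonoidAlgebra.single 0 c⁻¹) hmem
    rwa [AddMonoidAlgebra.single_mul_single, zero_add, mul_one] at this
  have hgI : (φ ^ n) g ∈ I := by
    change (φ ^ n) g ∈ I.toAddSubgroup
    rw [← show cartierSum p e φ 𝔞 t I = I.toAddSubgroup from hI]
    refine AddSubgroup.mem_iSup_of_mem n (AddSubgroup.mem_iSup_of_mem m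
      (AddSubgroup.mem_iSup_of_mem hnm ⟨g, hg, rfl⟩))
  have hcoeff : ∀ v', (inclusion k S ((φ ^ n) g)).coeff v' = if v' = v then 1 else 0 := by
    intro v'
    have h1 : (p ^ e) ^ n • v' + twist p e w n - (a : M) = u + (p ^ e) ^ n • (v' - v) := by
      change _ - ((p ^ e) ^ n • v + twist p e w n - u) = _
      rw [smul_sub]
      abel
    rw [hφ.coeff_pow_apply, coeff_inclusion_single_mul, h1]
    split_ifs with h
    · rw [h, sub_self, smul_zero, add_zero, inv_mul_cancel₀ hu, Function.iterate_fixed hκ]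
    · have h2 : (inclusion k S f).coeff (u + (p ^ e) ^ n • (v' - v)) = 0 := by
        by_contra h3
        exact h (sub_eq_zero.1 (hinj _ h3 _ rfl))
      rw [h2, mul_zero, iterate_map_zero]
  have hv : v ∈ S := mem_of_coeff_inclusion_ne_zero (f := (φ ^ n) g)
    (by rw [hcoeff, if_pos rfl]; exact one_ne_zero)
  refine ⟨hv, ?_⟩
  convert hgI
  ext s
  rw [← coeff_inclusion ((φ ^ n) g), hcoeff, AddMonoidAlgebra.coeff_single, Finsupp.single_apply]
  simp [Subtype.ext_iff, eq_comm]

end Fixed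

/-! ### Finitely many faces, finitely many exponent sets -/

section Faces

variable {M : Type*} [AddCommGroup M]

/-- The value of `l` at the point `(v + w / (p ^ e - 1), t)`. -/
def shiftedValue (p e : ℕ) (w : M) (t : ℚ) (l : M × ℤ →+ ℤ) (v : M) : ℚ :=
  l (v, 0) + l (w, 0) / ((p : ℚ) ^ e - 1) + t * l (0, 1)

/-- The geometric sum makes w_n equal to (q^n - 1) w/(q - 1), so the dominant term is q^n - 1 times
a number independent of n and u, whose sign decides for large n. -/
theorem map_slice_eq {p e : ℕ} (hpe : 2 ≤ p ^ e) (w : M) {t : ℚ} (l : M × ℤ →+ ℤ) (v u : M)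
    {n m : ℕ} (hm : (m : ℚ) = t * ((p : ℚ) ^ (n * e) - 1)) :
    ((l ((p ^ e) ^ n • v + twist p e w n - u, (m : ℤ)) : ℤ) : ℚ) =
      (((p : ℚ) ^ e) ^ n - 1) * shiftedValue p e w t l v + (l (v, 0) - l (u, 0)) := by
  have hq : ((p : ℚ) ^ e) - 1 ≠ 0 := by
    have : (2 : ℚ) ≤ (p : ℚ) ^ e := by exact_mod_cast hpe
    linarith
  have h1 : ((p ^ e) ^ n • v + twist p e w n - u, (m : ℤ)) =
      (p ^ e) ^ n • (v, (0 : ℤ)) + (∑ i ∈ Finset.range n, (p ^ e) ^ i) • (w, (0 : ℤ)) -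
        (u, (0 : ℤ)) + m • ((0 : M), (1 : ℤ)) := by
    simp [twist]
  rw [h1, map_add, map_sub, map_add, map_nsmul, map_nsmul, map_nsmul]
  simp only [nsmul_eq_mul]
  push_cast
  have h2 : (∑ i ∈ Finset.range n, ((p : ℚ) ^ e) ^ i) = (((p : ℚ) ^ e) ^ n - 1) / ((p : ℚ) ^ e - 1) :=
    geom_sum_eq (by intro h; exact hq (by rw [h, sub_self])) n
  rw [h2, hm, shiftedValue, mul_comm n e, pow_mul]
  field_simp
  ring

/-- A set `E` of lattice points such that `v ∈ E` can be tested on the inequalities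
`0 ≤ l (q ^ n v + w_n - u, t (q ^ n - 1))`, with `q = p ^ e` and `w_n = twist p e w n`, for
arbitrarily large `n` and for `u` in a finite set `U`. -/
def IsAsymptoticallyCut (p e : ℕ) (w : M) (t : ℚ) (L : Set (M × ℤ →+ ℤ)) (E : Set M) : Prop :=
  ∃ U : Set M, U.Finite ∧
    (∀ v ∈ E, ∀ N : ℕ, ∃ n m : ℕ, N ≤ n ∧ (0 < n ∧ (m : ℚ) = t * ((p : ℚ) ^ (n * e) - 1)) ∧
      ∃ u ∈ U, ∀ l ∈ L, 0 ≤ l ((p ^ e) ^ n • v + twist p e w n - u, (m : ℤ))) ∧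
    ∃ N : ℕ, ∀ v, ∀ n m : ℕ, N ≤ n → (0 < n ∧ (m : ℚ) = t * ((p : ℚ) ^ (n * e) - 1)) →
      ∀ u ∈ U, (∀ l ∈ L, 0 ≤ l ((p ^ e) ^ n • v + twist p e w n - u, (m : ℤ))) → v ∈ E

/-- The sets of exponents of fixed ideals are unions of the relative interiors of the faces of a
polyhedron, so there are finitely many. -/
theorem finite_exponent_sets {p e : ℕ} (hpe : 2 ≤ p ^ e) (w : M) (t : ℚ)
    {L : Set (M × ℤ →+ ℤ)} (hL : L.Finite) :
    {E : Set M | IsAsymptoticallyCut p e w t L E}.Finite := by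
  let F : M → Set (M × ℤ →+ ℤ) := fun v => {l ∈ L | shiftedValue p e w t l v = 0}
  have hlarge : ∀ x y : ℚ, 0 < x → ∃ N : ℕ, ∀ n, N ≤ n → 0 < (((p : ℚ) ^ e) ^ n - 1) * x + y := by
    intro x y hx
    obtain ⟨N, hN⟩ := exists_nat_gt (-y / x + 1)
    refine ⟨N, fun n hn => ?_⟩
    have h1 : (n : ℚ) < ((p : ℚ) ^ e) ^ n := by exact_mod_cast Nat.lt_pow_self (n := n) hpe
    have h2 : (N : ℚ) ≤ n := by exact_mod_cast hn
    have h3 : -y / x < ((p : ℚ) ^ e) ^ n - 1 := by linarith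
    rw [div_lt_iff₀ hx] at h3
    linarith
  -- E is recovered from the set of faces it meets, an element of the finite double powerset of L.
  refine Set.Finite.of_finite_image (f := fun E => F '' E) (hL.powerset.powerset.subset ?_) ?_
  · rintro _ ⟨E, -, rfl⟩ _ ⟨v, -, rfl⟩
    exact Set.sep_subset _ _
  have hnonneg : ∀ E, IsAsymptoticallyCut p e w t L E →
      ∀ v ∈ E, ∀ l ∈ L, 0 ≤ shiftedValue p e w t l v := by
    rintro E ⟨U, hU, h, -⟩ v hv l hl
    by_contra! hneg
    choose B hB using fun u : M =>
      hlarge (-shiftedValue p e w t l v) (-(l (v, 0) - l (u, 0))) (neg_pos.2 hneg)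
    obtain ⟨N, hN⟩ := (hU.image B).bddAbove
    obtain ⟨n, m, hn, ⟨-, hm⟩, u, hu, hpos⟩ := h v hv N
    have h1 := hB u n ((hN ⟨u, hu, rfl⟩).trans hn)
    have h2 : (0 : ℚ) ≤ (l ((p ^ e) ^ n • v + twist p e w n - u, (m : ℤ)) : ℤ) := by
      exact_mod_cast hpos l hl
    rw [map_slice_eq hpe w l v u hm] at h2
    linarith
  have key : ∀ E, IsAsymptoticallyCut p e w t L E → ∀ v ∈ E, ∀ v',
      (∀ l ∈ L, 0 ≤ shiftedValue p e w t l v') → F v = F v' → v' ∈ E := by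
    rintro E ⟨U, hU, hE, N, hN⟩ v hv v' hv' hF
    choose B hB using fun (l : M × ℤ →+ ℤ) (u : M) (h : 0 < shiftedValue p e w t l v') =>
      hlarge (shiftedValue p e w t l v') (l (v', 0) - l (u, 0)) h
    classical
    -- Forms vanishing at the shifted point need no threshold, hence the default 0.
    let B' := fun l u => if h : 0 < shiftedValue p e w t l v' then B l u h else 0
    obtain ⟨N', hN'⟩ := (hL.image2 B' hU).bddAbove
    obtain ⟨n, m, hn, hnm, u, hu, hpos⟩ := hE v hv (max N N')
    refine hN v' n m ((le_max_left _ _).trans hn) hnm u hu fun l hl => ?_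
    have h1 : (0 : ℚ) ≤ (l ((p ^ e) ^ n • v + twist p e w n - u, (m : ℤ)) : ℤ) := by
      exact_mod_cast hpos l hl
    have h2 : (0 : ℚ) ≤ (l ((p ^ e) ^ n • v' + twist p e w n - u, (m : ℤ)) : ℤ) := by
      rw [map_slice_eq hpe w l _ u hnm.2] at h1 ⊢
      rcases (hv' l hl).lt_or_eq with h | h
      · refine (hB l u h n ?_).le
        have := hN' ⟨l, hl, u, hu, rfl⟩
        simp only [B', dif_pos h] at this
        exact this.trans ((le_max_right _ _).trans hn)
      -- On a common face, both l(v) and l(v') equal -l(w)/(q-1) - t l(0,1), so the inequality for v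
      -- is the one for v'.
      · have h3 : l ∈ F v := hF ▸ ⟨hl, h.symm⟩
        have h4 := h3.2
        rw [← h]
        rw [h4] at h1
        have h5 : (l (v, 0) : ℚ) = l (v', 0) := by
          unfold shiftedValue at h h4
          linarith
        rw [← h5]
        exact h1
    exact_mod_cast h2
  intro E₁ hE₁ E₂ hE₂ h
  have half : ∀ E₁ E₂ : Set M, IsAsymptoticallyCut p e w t L E₁ →
      IsAsymptoticallyCut p e w t L E₂ → F '' E₁ = F '' E₂ → E₁ ⊆ E₂ := by
    intro E₁ E₂ hE₁ hE₂ h v hv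
    obtain ⟨v', hv', hF⟩ : F v ∈ F '' E₂ := h ▸ ⟨v, hv, rfl⟩
    exact key E₂ hE₂ v' hv' v (hnonneg E₁ hE₁ v hv) hF
  exact (half E₁ E₂ hE₁ hE₂ h).antisymm (half E₂ E₁ hE₂ hE₁ h.symm)

end Faces

end ToricCartier

/-! ### The finiteness theorem -/

open ToricCartier
theorem mainTheorem2 {p : ℕ} [Fact p.Prime] {k : Type*} [Field k] [CharP k p]
    {M : Type*} [AddCommGroup M] [IsAddTorsionFree M] [Module.Finite ℤ M]
    (σ : PointedCone ℝ (ℝ ⊗[ℤ] M)) (hσ : IsRationalPolyhedral σ)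
    (e : ℕ) (he : 0 < e) (κ : k →+ k) (hκ : IsFrobeniusSplitting p e κ) (w : M)
    (φ : AddMonoid.End (AddMonoidAlgebra k (latticePoints σ))) (hφ : IsToricMap p e κ w φ)
    (𝔞 : Ideal (AddMonoidAlgebra k (latticePoints σ))) (h𝔞 : IsMonomialIdeal 𝔞)
    (t : ℚ) (ht : 0 ≤ t) (htp : ¬ p ∣ t.den) :
    {I : Ideal (AddMonoidAlgebra k (latticePoints σ)) | IsCartierFixed p e φ 𝔞 t I}.Finite := by
  have := isNoetherianRing_semigroupRing (k := k) hσ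
  obtain ⟨L, hL, hLS, hLJ⟩ := exists_dual_integralClosure hσ h𝔞
  have hpe : 2 ≤ p ^ e := (Fact.out : p.Prime).two_le.trans (Nat.le_self_pow he.ne' p)
  have main : ∀ I : Ideal (AddMonoidAlgebra k (latticePoints σ)), IsCartierFixed p e φ 𝔞 t I →
      ∃ U : Set M, U.Finite ∧
      (∀ v ∈ exponents I, ∀ N : ℕ, ∃ n m : ℕ, N ≤ n ∧
        (0 < n ∧ (m : ℚ) = t * ((p : ℚ) ^ (n * e) - 1)) ∧
        ∃ u ∈ U, ∀ l ∈ L, 0 ≤ l ((p ^ e) ^ n • v + twist p e w n - u, (m : ℤ))) ∧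
      ∃ N : ℕ, ∀ v, ∀ n m : ℕ, N ≤ n → (0 < n ∧ (m : ℚ) = t * ((p : ℚ) ^ (n * e) - 1)) →
        ∀ u ∈ U, (∀ l ∈ L, 0 ≤ l ((p ^ e) ^ n • v + twist p e w n - u, (m : ℤ))) →
        ∃ hv : v ∈ latticePoints σ, AddMonoidAlgebra.single ⟨v, hv⟩ (1 : k) ∈ I := by
    intro I hI
    obtain ⟨T, hTI, hT⟩ := exists_finset_generators I
    let U : Set M := ⋃ f ∈ T, {u | (inclusion k (latticePoints σ) f).coeff u ≠ 0}
    have hmemU : ∀ u, u ∈ U ↔ ∃ f ∈ T, (inclusion k (latticePoints σ) f).coeff u ≠ 0 := by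
      simp [U]
    have hU : U.Finite := T.finite_toSet.biUnion fun f _ =>
      (inclusion k (latticePoints σ) f).coeff.hasFiniteSupport
    refine ⟨U, hU, fun v hv N => ?_, ?_⟩
    · obtain ⟨n, m, hn, hnm, a, ha, u, hu, hau⟩ := hI.exists_ge hφ (fun m => (hLJ m).1) hv N
      -- Passing from u to a generator's exponent u₀ leaves s ∈ σ, which is absorbed into a without
      -- changing the height.
      obtain ⟨f, hf, s, hs, u₀, hu₀, rfl⟩ := hT u hu
      refine ⟨n, m, hn, hnm, u₀, (hmemU _).2 ⟨f, hf, hu₀⟩, fun l hl => ?_⟩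
      have h1 : ((p ^ e) ^ n • v + twist p e w n - u₀, (m : ℤ)) = (a, (m : ℤ)) + (s, 0) := by
        rw [hau, Prod.mk_add_mk, add_zero, ← add_assoc, add_sub_cancel_right]
      rw [h1, map_add]
      exact add_nonneg (ha l hl) (hLS l hl s hs)
    · obtain ⟨N, hN⟩ := exists_forall_ne_add_smul hpe U hU
      refine ⟨N, fun v n m hn hnm u hu hpos => ?_⟩
      obtain ⟨f, hf, hfu⟩ := (hmemU u).1 hu
      exact hI.single_mem hφ hκ.1 hnm (hTI f hf) hfu
        (fun u' hu' x hx => hN n hn u hu u' ((hmemU _).2 ⟨f, hf, hu'⟩) x hx)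
        ((hLJ m).2 _ hpos)
  -- Both halves together show that every fixed ideal is monomial.
  have hsingle : ∀ I : Ideal (AddMonoidAlgebra k (latticePoints σ)), IsCartierFixed p e φ 𝔞 t I →
      ∀ v ∈ exponents I, ∃ hv : v ∈ latticePoints σ,
        AddMonoidAlgebra.single ⟨v, hv⟩ (1 : k) ∈ I := by
    intro I hI v hv
    obtain ⟨U, -, h1, N, h2⟩ := main I hI
    obtain ⟨n, m, hn, hnm, u, hu, hpos⟩ := h1 v hv N
    exact h2 v n m hn hnm u hu hpos
  refine Set.Finite.of_finite_image (f := exponents)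
    ((finite_exponent_sets hpe w t hL).subset ?_) ?_
  · rintro _ ⟨I, hI, rfl⟩
    obtain ⟨U, hU, h1, N, h2⟩ := main I hI
    refine ⟨U, hU, h1, N, fun v n m hn hnm u hu hpos => ?_⟩
    obtain ⟨hv, hmem⟩ := h2 v n m hn hnm u hu hpos
    refine ⟨_, hmem, ?_⟩
    rw [coeff_inclusion _ (⟨v, hv⟩ : latticePoints σ)]
    simp
  · intro I hI J hJ h
    exact (ideal_le_of_exponents_subset h.subset (hsingle J hJ)).antisymm
      (ideal_le_of_exponents_subset h.superset (hsingle I hI))
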